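/- Let $n\ge 1$, let $[n]=\{1,\dots,n-1\}$, and let $M=B_n^+$ be the monoid of positive braids on $n$ strands, that is, the monoid generated by $\sigma_1,\dots,\sigma_{n-1}$ subject to the relations $\sigma_i\sigma_j=\sigma_j\sigma_i$ for $|i-j|>1$ and $\sigma_i\sigma_j\sigma_i=\sigma_j\sigma_i\sigma_j$ for $|i-j|=1$ (equivalently, the submonoid of the braid group $B_n$ generated by the standard generators). For $\beta\in M$, let $\omega(\beta)$ be the lexicographically smallest word in the letters $\sigma_1<\sigma_2<\dots<\sigma_{n-1}$ that represents $\beta$, and let $L_n=\{\omega(\beta)\mid\beta\in M\}$. For $w\in L_n$, let $F_n(w)=\{\alpha\in M\mid w\,\omega(\alpha)\notin L_n\}$, and let $F_n^{\min}(w)$ be the set of elements of $F_n(w)$ that are minimal with respect to the prefix order $\preccurlyeq$ on $M$ (where $a\preccurlyeq b$ if and only if $ac=b$ for some $c\in M$). A function $f:[n]\to\{-1,0\}\cup[n]$ is called admissible if $f(i)\le i$ for all $i\in[n]$ and $f(1)\ne -1$; for such $f$ put $$F_f=\{\sigma_i\sigma_{i-1}\cdots\sigma_{f(i)}\mid i\in[n],\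 f(i)\ge 1\}\cup\{\sigma_{i-1}\sigma_i\mid i\in[n],\ f(i)=-1\}\subset M.$$ Let $w\in L_n$. Then the following hold. 1. There is a unique admissible function $f$ such that $F_n^{\min}(w)=F_f$. 2. Let $f$ be admissible with $F_n^{\min}(w)=F_f$, and let $j\in[n]$. Then $w\sigma_j\in L_n$ if and only if $f(j)\ne j$. Moreover, in this case the function $g$ on $[n]$ given as follows is admissible, and $F_n^{\min}(w\sigma_j)=F_g$: - for $i<j-1$: $g(i)=i$; - if $j>1$: $g(j-1)=f(j)$ if $f(j)>0$, and $g(j-1)=0$ otherwise; - $g(j)=0$ if $j=1$ or $f(j)=j-1$, and $g(j)=-1$ otherwise; - for $i>j$: $g(i)=i$ if $f(i)=-1$; $g(i)=j$ if $f(i)=j+1$; and $g(i)=f(i)$ otherwise. 3. The set $F_n^{\min}(w)$ is finite, and $|F_n^{\min}(w)|\le n-1$. -/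

import Mathlib

namespace PosBraid

/-- The index set `[n] = {1, …, n - 1}` of the standard generators of `B_n⁺`, linearly ordered by
`1 < 2 < ⋯ < n - 1`. The index `i` stands for the letter `σ_i`, so that words in
`σ_1, …, σ_{n-1}` are the elements of `List (Idx n)`. -/
abbrev Idx (n : ℕ) : Type := {i : ℕ // 1 ≤ i ∧ i < n}

/-- The defining relations of the positive braid monoid. -/
inductive BraidRel (n : ℕ) : FreeMonoid (Idx n) → FreeMonoid (Idx n) → Prop
  | comm (i j : Idx n) (h : i.1 + 1 < j.1) :
      BraidRel n (FreeMonoid.of i * FreeMonoid.of j) (FreeMonoid.of j * FreeMonoid.of i)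
  | braid (i j : Idx n) (h : i.1 + 1 = j.1) :
      BraidRel n (FreeMonoid.of i * FreeMonoid.of j * FreeMonoid.of i)
        (FreeMonoid.of j * FreeMonoid.of i * FreeMonoid.of j)

/-- The monoid `M = B_n⁺` of positive braids on `n` strands. -/
abbrev BraidMonoid (n : ℕ) : Type := PresentedMonoid (BraidRel n)

/-- The standard generator `σ_i`, for `i ∈ [n]`. -/
def gen {n : ℕ} (i : Idx n) : BraidMonoid n := PresentedMonoid.of (BraidRel n) i

/-- The braid represented by a word: the canonical morphism from words to `B_n⁺`. -/
def toBraid {n : ℕ} (w : List (Idx n)) : BraidMonoid n := (w.map gen).prod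

/-- The length homomorphism on `B_n⁺`, which sends each generator to `1`. -/
def lengthHom (n : ℕ) : BraidMonoid n →* Multiplicative ℕ :=
  PresentedMonoid.lift (fun _ => Multiplicative.ofAdd 1) (by
    rintro a b (⟨i, j, h⟩ | ⟨i, j, h⟩) <;> simp)

theorem lengthHom_toBraid {n : ℕ} (w : List (Idx n)) :
    lengthHom n (toBraid w) = Multiplicative.ofAdd w.length := by
  induction w with
  | nil => simp [toBraid]
  | cons i w ih =>
    have h : lengthHom n (gen i) = Multiplicative.ofAdd 1 := rfl
    have h2 : toBraid (i :: w) = gen i * toBraid w := by simp [toBraid]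
    rw [h2, map_mul, h, ih, ← ofAdd_add, List.length_cons, add_comm]

theorem toBraid_surjective (n : ℕ) : Function.Surjective (toBraid (n := n)) := by
  intro β
  obtain ⟨a, rfl⟩ := PresentedMonoid.surjective_mk β
  refine ⟨a.toList, ?_⟩
  have h : FreeMonoid.lift gen = PresentedMonoid.mk (BraidRel n) :=
    FreeMonoid.hom_eq fun i => by simp [gen, PresentedMonoid.of]
  rw [← h, FreeMonoid.lift_apply]
  rfl

/-- The words representing `β` have a minimum in the lexicographical order (the order that Mathlib
puts on lists; these words all have the same length). -/
theorem exists_isLeast {n : ℕ} (β : BraidMonoid n) :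
    ∃ w : List (Idx n), IsLeast {v : List (Idx n) | toBraid v = β} w := by
  obtain ⟨w₀, hw₀⟩ := toBraid_surjective n β
  have : Finite (Idx n) := Finite.of_injective (fun i : Idx n => (⟨i.1, i.2.2⟩ : Fin n))
    (fun i j h => Subtype.ext (by simpa using h))
  have hfin : {v : List (Idx n) | toBraid v = β}.Finite := by
    refine (List.finite_length_eq (Idx n) w₀.length).subset ?_
    intro v hv
    have hv' : toBraid v = toBraid w₀ := hv.trans hw₀.symm
    have := congrArg (lengthHom n) hv'
    rw [lengthHom_toBraid, lengthHom_toBraid] at this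
    exact Multiplicative.ofAdd.injective this
  obtain ⟨w, hw, hmin⟩ := Set.exists_min_image _ id hfin ⟨w₀, hw₀⟩
  exact ⟨w, hw, fun v hv => hmin v hv⟩

/-- The lex-representative `ω(β)`: the lexicographically smallest word that represents `β`. -/
noncomputable def lexRep {n : ℕ} (β : BraidMonoid n) : List (Idx n) := (exists_isLeast β).choose

/-- The set `L_n` of all words that are lex-representatives. -/
def lexLang (n : ℕ) : Set (List (Idx n)) := Set.range (lexRep (n := n))

/-- The set `F_n(w)` of forbidden prefixes after `w`. -/
def forbidden {n : ℕ} (w : List (Idx n)) : Set (BraidMonoid n) :=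
  {α | w ++ lexRep α ∉ lexLang n}

/-- The prefix relation `a ≼ b`. -/
def IsPrefix {n : ℕ} (a b : BraidMonoid n) : Prop := ∃ c, a * c = b

/-- The set `F_n^min(w)` of minimal forbidden prefixes after `w`: the elements of `F_n(w)` that are
minimal for `≼`. -/
def minForbidden {n : ℕ} (w : List (Idx n)) : Set (BraidMonoid n) :=
  {α | α ∈ forbidden w ∧ ∀ β ∈ forbidden w, IsPrefix β α → β = α}

/-- The generator `σ_k` with a natural number as index; the default value `1` for `k ∉ [n]` is
never used below for an admissible function. -/
def sigma (n k : ℕ) : BraidMonoid n := if h : 1 ≤ k ∧ k < n then gen ⟨k, h⟩ else 1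

/-- The braid `σ_i σ_{i-1} ⋯ σ_m`, for `1 ≤ m ≤ i < n`. -/
def descending (n i m : ℕ) : BraidMonoid n :=
  ((List.range' m (i + 1 - m)).reverse.map (sigma n)).prod

/-- A function `f : [n] → {-1, 0} ∪ [n]` is admissible if `f i ≤ i` for all `i` and `f 1 ≠ -1`. -/
structure Admissible {n : ℕ} (f : Idx n → ℤ) : Prop where
  mem_codomain : ∀ i, f i = -1 ∨ f i = 0 ∨ (1 ≤ f i ∧ f i < n)
  le_self : ∀ i, f i ≤ i.1
  one_ne : ∀ i, i.1 = 1 → f i ≠ -1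

/-- The set `F_f` that an admissible function `f` encodes. -/
def encoded {n : ℕ} (f : Idx n → ℤ) : Set (BraidMonoid n) :=
  {x | ∃ i : Idx n, 1 ≤ f i ∧ x = descending n i.1 (f i).toNat} ∪
    {x | ∃ i : Idx n, f i = -1 ∧ x = sigma n (i.1 - 1) * sigma n i.1}

/-- The function `g` that is obtained from `f` when the letter `σ_j` is appended. -/
def update {n : ℕ} (f : Idx n → ℤ) (j : Idx n) (i : Idx n) : ℤ :=
  if i.1 + 1 < j.1 then (i.1 : ℤ)
  else if i.1 + 1 = j.1 then (if 0 < f j then f j else 0)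
  else if i.1 = j.1 then (if j.1 = 1 ∨ f j = (j.1 : ℤ) - 1 then 0 else -1)
  else if f i = -1 then (i.1 : ℤ)
  else if f i = (j.1 : ℤ) + 1 then (j.1 : ℤ)
  else f i

end PosBraid

namespace PosBraid

variable {n : ℕ}

/-! A word is lexicographically minimal exactly when, for each letter `σ_k` in it, no smaller
generator divides the braid of the suffix starting there (`cons_mem_lexLang_iff`). Hence `α` is
forbidden after `wσ_j` iff `σ_j α` is forbidden after `w` or some `σ_i` with `i < j` divides `σ_j α`
(`follows_concat_iff`). Forbidden sets are closed under right multiplication, so it suffices to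
track generators: the `α` with `x ≼ σ_j α` are the multiples of the `y` for which `σ_j y` is the
least common multiple of `σ_j` and `x`.

Garside's lemma `amalgam_of_eq` computes these `y`. The clause `i < j` contributes `σ_i` for `i < j
- 1` and `σ_{j-1}σ_j`. A descending product with first letter above `σ_j` is unchanged or gains
`σ_j` at its end; one starting with `σ_j` loses that letter; one with a smaller first letter becomes
redundant. This is the passage from `f` to `g` (`covers_update_iff`). It needs the invariant
`Reduced`, which also makes `encoded f` an antichain, hence the set of minimal elements. Uniqueness
is `encoded_injective`. -/

/-! ### Words, length and Garside's lemma -/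

theorem toBraid_cons (i : Idx n) (w : List (Idx n)) : toBraid (i :: w) = gen i * toBraid w := by
  simp [toBraid]

theorem toBraid_append (v w : List (Idx n)) : toBraid (v ++ w) = toBraid v * toBraid w := by
  simp [toBraid]

theorem toBraid_nil : toBraid ([] : List (Idx n)) = 1 := by
  simp [toBraid]

theorem toBraid_eq_mk (w : List (Idx n)) :
    toBraid w = PresentedMonoid.mk (BraidRel n) (FreeMonoid.ofList w) := by
  induction w with
  | nil => simp [toBraid_nil]
  | cons i w ih => rw [toBraid_cons, ih, FreeMonoid.ofList_cons, map_mul]; rfl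

/-- The word length of a positive braid. -/
def len (a : BraidMonoid n) : ℕ := (lengthHom n a).toAdd

@[simp] theorem len_one : len (1 : BraidMonoid n) = 0 := by simp [len]

@[simp] theorem len_mul (a b : BraidMonoid n) : len (a * b) = len a + len b := by simp [len]

@[simp] theorem len_gen (i : Idx n) : len (gen i) = 1 := rfl

@[simp] theorem len_toBraid (w : List (Idx n)) : len (toBraid w) = w.length := by
  simp [len, lengthHom_toBraid]

/-- The generators `σ_i` and `σ_j` satisfy the commutation relation. -/
def Far (i j : Idx n) : Prop := i.1 + 1 < j.1 ∨ j.1 + 1 < i.1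

/-- The generators `σ_i` and `σ_j` satisfy the braid relation. -/
def Adj (i j : Idx n) : Prop := i.1 + 1 = j.1 ∨ j.1 + 1 = i.1

theorem Far.symm {i j : Idx n} (h : Far i j) : Far j i := Or.symm h

theorem Adj.symm {i j : Idx n} (h : Adj i j) : Adj j i := Or.symm h

theorem eq_or_far_or_adj (i j : Idx n) : i = j ∨ Far i j ∨ Adj i j := by
  rw [Subtype.ext_iff]
  unfold Far Adj
  omega

theorem Far.comm {i j : Idx n} (h : Far i j) (a : BraidMonoid n) :
    gen i * (gen j * a) = gen j * (gen i * a) := by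
  have key : ∀ i j : Idx n, i.1 + 1 < j.1 → gen i * gen j = gen j * gen i := fun i j h =>
    PresentedMonoid.mk_eq_mk_of_rel (BraidRel.comm i j h)
  rw [← mul_assoc, ← mul_assoc]
  rcases h with h | h
  · rw [key i j h]
  · rw [key j i h]

theorem Adj.braid {i j : Idx n} (h : Adj i j) (a : BraidMonoid n) :
    gen i * (gen j * (gen i * a)) = gen j * (gen i * (gen j * a)) := by
  have key : ∀ i j : Idx n, i.1 + 1 = j.1 → gen i * gen j * gen i = gen j * gen i * gen j :=
    fun i j h => PresentedMonoid.mk_eq_mk_of_rel (BraidRel.braid i j h)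
  simp only [← mul_assoc]
  rcases h with h | h
  · rw [key i j h]
  · rw [key j i h]

/-- `Amalgam i a j b` says that `σ_i a = σ_j b` holds because both sides are a multiple of the least
common multiple of `σ_i` and `σ_j`. -/
def Amalgam (i : Idx n) (a : BraidMonoid n) (j : Idx n) (b : BraidMonoid n) : Prop :=
  (i = j ∧ a = b) ∨ (Far i j ∧ ∃ c, a = gen j * c ∧ b = gen i * c) ∨
    (Adj i j ∧ ∃ c, a = gen j * (gen i * c) ∧ b = gen i * (gen j * c))

theorem Amalgam.symm {i j : Idx n} {a b : BraidMonoid n} (h : Amalgam i a j b) :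
    Amalgam j b i a := by
  rcases h with ⟨rfl, rfl⟩ | ⟨h, c, rfl, rfl⟩ | ⟨h, c, rfl, rfl⟩
  · exact Or.inl ⟨rfl, rfl⟩
  · exact Or.inr (Or.inl ⟨h.symm, c, rfl, rfl⟩)
  · exact Or.inr (Or.inr ⟨h.symm, c, rfl, rfl⟩)

theorem Amalgam.mul_right {i j : Idx n} {a b : BraidMonoid n} (h : Amalgam i a j b)
    (d : BraidMonoid n) : Amalgam i (a * d) j (b * d) := by
  rcases h with ⟨rfl, rfl⟩ | ⟨h, c, rfl, rfl⟩ | ⟨h, c, rfl, rfl⟩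
  · exact Or.inl ⟨rfl, rfl⟩
  · exact Or.inr (Or.inl ⟨h, c * d, by simp [mul_assoc], by simp [mul_assoc]⟩)
  · exact Or.inr (Or.inr ⟨h, c * d, by simp [mul_assoc], by simp [mul_assoc]⟩)

/-- Equalities between braids of length at most `L` whose first letters are singled out come from
least common multiples of generators. -/
def AmalgamUpTo (n L : ℕ) : Prop :=
  ∀ (i j : Idx n) (a b : BraidMonoid n), len a < L → gen i * a = gen j * b → Amalgam i a j b

theorem Amalgam.of_far {i j : Idx n} (h : Far i j) {a b : BraidMonoid n} (H : Amalgam i a j b) :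
    ∃ c, a = gen j * c ∧ b = gen i * c := by
  unfold Amalgam Far Adj at *
  rw [Subtype.ext_iff] at H
  rcases H with ⟨h', _⟩ | ⟨_, H⟩ | ⟨h', _⟩
  · omega
  · exact H
  · omega

theorem Amalgam.of_adj {i j : Idx n} (h : Adj i j) {a b : BraidMonoid n} (H : Amalgam i a j b) :
    ∃ c, a = gen j * (gen i * c) ∧ b = gen i * (gen j * c) := by
  unfold Amalgam Far Adj at *
  rw [Subtype.ext_iff] at H
  rcases H with ⟨h', _⟩ | ⟨h', _⟩ | ⟨_, H⟩
  · omega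
  · omega
  · exact H

theorem Amalgam.of_eq {i : Idx n} {a b : BraidMonoid n} (H : Amalgam i a i b) : a = b := by
  unfold Amalgam Far Adj at H
  rcases H with ⟨_, h⟩ | ⟨h, _⟩ | ⟨h, _⟩
  · exact h
  · omega
  · omega

/-- The cube condition for three generators, two adjacent and one far from `j`; `k` may be far from
`i` or the middle strand generator. The induction hypothesis is applied to ever shorter equalities
until a common multiple of all three generators appears. -/
theorem amalgam_trans_far_adj {L : ℕ} (ih : AmalgamUpTo n L) {i j k : Idx n}
    {c d : BraidMonoid n} (hij : Far i j) (hjk : Adj j k)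
    (hz : gen i * c = gen k * (gen j * d)) (hL : len c < L) :
    Amalgam i (gen j * c) k (gen j * (gen k * d)) := by
  have hlen := congrArg len hz
  simp only [len_mul, len_gen] at hlen
  have H := ih i k _ _ hL hz
  rcases eq_or_far_or_adj i k with rfl | hik | hik
  · unfold Far Adj at *
    omega
  · obtain ⟨e, rfl, he⟩ := H.of_far hik
    obtain ⟨f, rfl, rfl⟩ := (ih j i _ _ (by omega) he).of_far hij.symm
    refine Or.inr (Or.inl ⟨hik, gen j * (gen k * f), ?_, ?_⟩)
    · rw [hjk.braid]
    · rw [hik.symm.comm, hij.symm.comm]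
  · obtain ⟨e, rfl, he⟩ := H.of_adj hik
    have hlen' := congrArg len he
    simp only [len_mul, len_gen] at hlen' hL hlen
    obtain ⟨f, rfl, hf⟩ := (ih j i _ _ (by omega) he).of_far hij.symm
    obtain ⟨g, rfl, rfl⟩ := (ih k j _ _ (by omega) hf).of_adj hjk.symm
    refine Or.inr (Or.inr ⟨hik, gen j * (gen k * (gen i * g)), ?_, ?_⟩)
    · rw [hij.comm, hjk.braid, hik.symm.braid, hij.symm.comm]
    · rw [hik.symm.braid, hij.symm.comm, hij.comm g, hjk.braid]

theorem amalgam_trans_adj_adj {L : ℕ} (ih : AmalgamUpTo n L) {i j k : Idx n}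
    {c d : BraidMonoid n} (hij : Adj i j) (hjk : Adj j k) (hik : Far i k)
    (hz : gen i * (gen j * c) = gen k * (gen j * d)) (hL : len c + 1 < L) :
    Amalgam i (gen j * (gen i * c)) k (gen j * (gen k * d)) := by
  have hlen := congrArg len hz
  simp only [len_mul, len_gen] at hlen
  obtain ⟨e, he, he'⟩ := (ih i k _ _ (by simp; omega) hz).of_far hik
  obtain ⟨f, rfl, rfl⟩ := (ih j k _ _ (by omega) he).of_adj hjk
  obtain ⟨g, rfl, hg⟩ := (ih j i _ _ (by omega) he').of_adj hij.symm
  simp only [len_mul, len_gen] at hL hlen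
  have hg1 := (ih j j _ _ (by simp; omega) hg).of_eq
  obtain ⟨h, rfl, rfl⟩ := (ih k i _ _ (by omega) hg1).of_far hik.symm
  refine Or.inr (Or.inl ⟨hik, gen j * (gen i * (gen k * (gen j * h))), ?_, ?_⟩)
  · rw [hik.comm, hij.braid, hjk.braid, hik.comm]
  · rw [hik.symm.comm, hjk.symm.braid, hij.symm.braid]

/-- Unless `i = j` or `j = k`, the middle braid `z` has one factorization starting with `σ_i` and
another with `σ_k`. It is shorter than `σ_j z`, so the induction hypothesis applies to it. -/
theorem Amalgam.trans {L : ℕ} (ih : AmalgamUpTo n L) {i j k : Idx n} {a z b : BraidMonoid n}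
    (hL : len z ≤ L) (h₁ : Amalgam i a j z) (h₂ : Amalgam j z k b) : Amalgam i a k b := by
  rcases h₁ with ⟨rfl, rfl⟩ | ⟨hij, c, rfl, rfl⟩ | ⟨hij, c, rfl, rfl⟩
  · exact h₂
  · simp only [len_mul, len_gen] at hL
    rcases h₂ with ⟨rfl, rfl⟩ | ⟨hjk, d, hd, rfl⟩ | ⟨hjk, d, hd, rfl⟩
    · exact Or.inr (Or.inl ⟨hij, c, rfl, rfl⟩)
    · rcases ih i k _ _ (by omega) hd with ⟨rfl, rfl⟩ | ⟨hik, e, rfl, rfl⟩ | ⟨hik, e, rfl, rfl⟩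
      · exact Or.inl ⟨rfl, rfl⟩
      · exact Or.inr (Or.inl ⟨hik, gen j * e, hjk.comm _, hij.symm.comm _⟩)
      · refine Or.inr (Or.inr ⟨hik, gen j * e, ?_, ?_⟩)
        · rw [hjk.comm, hij.comm]
        · rw [hij.symm.comm, hjk.comm]
    · exact amalgam_trans_far_adj ih hij hjk hd (by omega)
  · simp only [len_mul, len_gen] at hL
    rcases h₂ with ⟨rfl, rfl⟩ | ⟨hjk, d, hd, rfl⟩ | ⟨hjk, d, hd, rfl⟩
    · exact Or.inr (Or.inr ⟨hij, c, rfl, rfl⟩)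
    · have := congrArg len hd
      simp only [len_mul, len_gen] at this
      exact (amalgam_trans_far_adj ih hjk.symm hij.symm hd.symm (by omega)).symm
    · rcases eq_or_far_or_adj i k with rfl | hik | hik
      · have h1 := (ih i i _ _ (by simp; omega) hd).of_eq
        have h2 := (ih j j _ _ (by omega) h1).of_eq
        exact Or.inl ⟨rfl, by rw [h2]⟩
      · exact amalgam_trans_adj_adj ih hij hjk hik hd (by omega)
      · unfold Adj at *
        omega

/-- The relation `Amalgam` read on words. -/
def AmalgamWords : List (Idx n) → List (Idx n) → Prop
  | i :: u, j :: v => Amalgam i (toBraid u) j (toBraid v)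
  | _, _ => True

/-- Induction on a derivation of the congruence. Equality of braids is carried along because it
forces equal word lengths, so the length bound passes to intermediate words. -/
theorem amalgamWords_of_rel {L : ℕ} (ih : AmalgamUpTo n L) {u v : FreeMonoid (Idx n)}
    (h : ConGen.Rel (BraidRel n) u v) :
    toBraid u.toList = toBraid v.toList ∧
      (u.toList.length ≤ L + 1 → AmalgamWords u.toList v.toList) := by
  induction h with
  | of u v h =>
    have hr := PresentedMonoid.mk_eq_mk_of_rel h
    refine ⟨by rw [toBraid_eq_mk, toBraid_eq_mk]; exact hr, fun _ => ?_⟩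
    rcases h with ⟨i, j, h⟩ | ⟨i, j, h⟩
    · exact Or.inr (Or.inl ⟨Or.inl h, 1, by simp [toBraid], by simp [toBraid]⟩)
    · exact Or.inr (Or.inr ⟨Or.inl h, 1, by simp [toBraid], by simp [toBraid]⟩)
  | refl u =>
    refine ⟨rfl, fun _ => ?_⟩
    rcases u.toList with _ | ⟨i, u⟩
    · trivial
    · exact Or.inl ⟨rfl, rfl⟩
  | @symm u v _ hs =>
    have hl := congrArg len hs.1
    simp only [len_toBraid] at hl
    refine ⟨hs.1.symm, fun hL => ?_⟩
    have := hs.2 (by omega)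
    revert this
    rcases u.toList with _ | ⟨i, u⟩ <;> rcases v.toList with _ | ⟨j, v⟩
    · exact id
    · exact id
    · exact id
    · exact Amalgam.symm
  | @trans u v w _ _ h1 h2 =>
    have hl1 := congrArg len h1.1
    have hl2 := congrArg len h2.1
    simp only [len_toBraid] at hl1 hl2
    refine ⟨h1.1.trans h2.1, fun hL => ?_⟩
    have H1 := h1.2 (by omega)
    have H2 := h2.2 (by omega)
    -- `AmalgamWords` is vacuous on empty words; equal lengths exclude an empty middle word between
    -- nonempty ones.
    revert H1 H2 hl1 hl2 hL
    rcases u.toList with _ | ⟨i, u⟩ <;> rcases v.toList with _ | ⟨j, v⟩ <;>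
      rcases w.toList with _ | ⟨k, w⟩ <;> simp [AmalgamWords]
    intro hL hl1 hl2 H1 H2
    exact Amalgam.trans ih (by simp; omega) H1 H2
  | @mul u v u' v' _ _ h1 h2 =>
    have hl1 := congrArg len h1.1
    simp only [len_toBraid] at hl1
    refine ⟨by simp only [FreeMonoid.toList_mul, toBraid_append, h1.1, h2.1], fun hL => ?_⟩
    simp only [FreeMonoid.toList_mul, List.length_append] at hL ⊢
    have H1 := h1.2 (by omega)
    have H2 := h2.2 (by omega)
    revert H1 hl1
    rcases u.toList with _ | ⟨i, u⟩ <;> rcases v.toList with _ | ⟨j, v⟩ <;>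
      simp [AmalgamWords]
    · exact H2
    · intro _ H1
      rw [toBraid_append, toBraid_append, h2.1]
      exact H1.mul_right _

theorem amalgamUpTo (L : ℕ) : AmalgamUpTo n L := by
  induction L with
  | zero => intro i j a b h; omega
  | succ L ih =>
    intro i j a b hL h
    obtain ⟨u, rfl⟩ := toBraid_surjective n a
    obtain ⟨v, rfl⟩ := toBraid_surjective n b
    rw [← toBraid_cons, ← toBraid_cons, toBraid_eq_mk, toBraid_eq_mk] at h
    have h' : ConGen.Rel (BraidRel n) (FreeMonoid.ofList (i :: u)) (FreeMonoid.ofList (j :: v)) :=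
      (Con.eq _).1 h
    refine (amalgamWords_of_rel ih h').2 ?_
    simp at hL ⊢
    omega

/-- **Garside's lemma**: `σ_i a = σ_j b` holds only for multiples of the least common multiple. -/
theorem amalgam_of_eq {i j : Idx n} {a b : BraidMonoid n} (h : gen i * a = gen j * b) :
    Amalgam i a j b :=
  amalgamUpTo _ i j a b (Nat.lt_succ_self _) h

theorem gen_mul_cancel {i : Idx n} {a b : BraidMonoid n} (h : gen i * a = gen i * b) : a = b :=
  (amalgam_of_eq h).of_eq

/-! ### The prefix order and divisibility after multiplying by a generator -/

theorem IsPrefix.refl (a : BraidMonoid n) : IsPrefix a a := ⟨1, mul_one a⟩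

theorem IsPrefix.trans {a b c : BraidMonoid n} (h₁ : IsPrefix a b) (h₂ : IsPrefix b c) :
    IsPrefix a c := by
  obtain ⟨x, rfl⟩ := h₁
  obtain ⟨y, rfl⟩ := h₂
  exact ⟨x * y, (mul_assoc _ _ _).symm⟩

theorem one_isPrefix (a : BraidMonoid n) : IsPrefix 1 a := ⟨a, one_mul a⟩

theorem isPrefix_mul_right (a b : BraidMonoid n) : IsPrefix a (a * b) := ⟨b, rfl⟩

theorem IsPrefix.mul_left {a b : BraidMonoid n} (h : IsPrefix a b) (c : BraidMonoid n) :
    IsPrefix (c * a) (c * b) := by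
  obtain ⟨x, rfl⟩ := h
  exact ⟨x, mul_assoc _ _ _⟩

theorem IsPrefix.len_le {a b : BraidMonoid n} (h : IsPrefix a b) : len a ≤ len b := by
  obtain ⟨x, rfl⟩ := h
  simp

theorem sigma_eq_gen (i : Idx n) : sigma n i.1 = gen i := by
  simp [sigma, i.2]

theorem sigma_of_mem {i : ℕ} (hi : 1 ≤ i ∧ i < n) : sigma n i = gen ⟨i, hi⟩ := by
  simp [sigma, hi]

theorem len_sigma {i : ℕ} (hi : 1 ≤ i ∧ i < n) : len (sigma n i) = 1 := by
  rw [sigma_of_mem hi, len_gen]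

theorem mul_isPrefix_iff {a x α : BraidMonoid n} :
    IsPrefix (a * x) α ↔ ∃ β, α = a * β ∧ IsPrefix x β := by
  constructor
  · rintro ⟨c, rfl⟩
    exact ⟨x * c, mul_assoc _ _ _, c, rfl⟩
  · rintro ⟨β, rfl, h⟩
    exact h.mul_left a

theorem sigma_mul_isPrefix_sigma_mul_iff {i : ℕ} (hi : 1 ≤ i ∧ i < n) {x α : BraidMonoid n} :
    IsPrefix (sigma n i * x) (sigma n i * α) ↔ IsPrefix x α := by
  refine ⟨?_, fun h => h.mul_left _⟩
  rintro ⟨c, hc⟩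
  rw [sigma_of_mem hi, mul_assoc] at hc
  exact ⟨c, gen_mul_cancel hc⟩

/-- Garside's lemma peels the first letter off the divisor and leaves a question about the shorter
divisor `x`; the inductions on descending products rest on this. -/
theorem sigma_mul_isPrefix_sigma_mul_of_far {i j : ℕ} (hi : 1 ≤ i ∧ i < n) (hj : 1 ≤ j ∧ j < n)
    (h : i + 1 < j ∨ j + 1 < i) {x α : BraidMonoid n} :
    IsPrefix (sigma n i * x) (sigma n j * α) ↔
      ∃ β, α = sigma n i * β ∧ IsPrefix x (sigma n j * β) := by
  have hf : Far (⟨i, hi⟩ : Idx n) ⟨j, hj⟩ := h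
  rw [sigma_of_mem hi, sigma_of_mem hj]
  constructor
  · rintro ⟨c, hc⟩
    rw [mul_assoc] at hc
    obtain ⟨d, hd, rfl⟩ := (amalgam_of_eq hc).of_far hf
    exact ⟨d, rfl, c, hd⟩
  · rintro ⟨β, rfl, c, hc⟩
    exact ⟨c, by rw [mul_assoc, hc, hf.comm]⟩

theorem sigma_mul_isPrefix_sigma_mul_of_adj {i j : ℕ} (hi : 1 ≤ i ∧ i < n) (hj : 1 ≤ j ∧ j < n)
    (h : i + 1 = j ∨ j + 1 = i) {x α : BraidMonoid n} :
    IsPrefix (sigma n i * x) (sigma n j * α) ↔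
      ∃ β, α = sigma n i * (sigma n j * β) ∧ IsPrefix x (sigma n j * (sigma n i * β)) := by
  have hf : Adj (⟨i, hi⟩ : Idx n) ⟨j, hj⟩ := h
  rw [sigma_of_mem hi, sigma_of_mem hj]
  constructor
  · rintro ⟨c, hc⟩
    rw [mul_assoc] at hc
    obtain ⟨d, hd, rfl⟩ := (amalgam_of_eq hc).of_adj hf
    exact ⟨d, rfl, c, hd⟩
  · rintro ⟨β, rfl, c, hc⟩
    exact ⟨c, by rw [mul_assoc, hc, hf.braid]⟩

theorem sigma_isPrefix_iff {i : ℕ} {α : BraidMonoid n} :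
    IsPrefix (sigma n i) α ↔ ∃ β, α = sigma n i * β :=
  ⟨fun ⟨c, hc⟩ => ⟨c, hc.symm⟩, fun ⟨c, hc⟩ => ⟨c, hc.symm⟩⟩

theorem sigma_isPrefix_sigma_mul_of_far {i j : ℕ} (hi : 1 ≤ i ∧ i < n) (hj : 1 ≤ j ∧ j < n)
    (h : i + 1 < j ∨ j + 1 < i) {α : BraidMonoid n} :
    IsPrefix (sigma n i) (sigma n j * α) ↔ IsPrefix (sigma n i) α := by
  have := sigma_mul_isPrefix_sigma_mul_of_far hi hj h (x := 1) (α := α)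
  rw [mul_one] at this
  rw [this, sigma_isPrefix_iff]
  simp [one_isPrefix]

theorem sigma_isPrefix_sigma_mul_of_adj {i j : ℕ} (hi : 1 ≤ i ∧ i < n) (hj : 1 ≤ j ∧ j < n)
    (h : i + 1 = j ∨ j + 1 = i) {α : BraidMonoid n} :
    IsPrefix (sigma n i) (sigma n j * α) ↔ IsPrefix (sigma n i * sigma n j) α := by
  have := sigma_mul_isPrefix_sigma_mul_of_adj hi hj h (x := 1) (α := α)
  rw [mul_one] at this
  rw [this, mul_isPrefix_iff]
  constructor
  · rintro ⟨β, rfl, -⟩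
    exact ⟨_, rfl, isPrefix_mul_right _ _⟩
  · rintro ⟨β, rfl, h⟩
    obtain ⟨γ, rfl⟩ := sigma_isPrefix_iff.1 h
    exact ⟨γ, rfl, one_isPrefix _⟩

theorem eq_of_sigma_isPrefix_sigma {i j : ℕ} (hi : 1 ≤ i ∧ i < n) (hj : 1 ≤ j ∧ j < n)
    (h : IsPrefix (sigma n i) (sigma n j)) : i = j := by
  by_contra hne
  rw [← mul_one (sigma n j)] at h
  by_cases hf : i + 1 < j ∨ j + 1 < i
  · have := ((sigma_isPrefix_sigma_mul_of_far hi hj hf).1 h).len_le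
    simp [len_sigma hi] at this
  · have := ((sigma_isPrefix_sigma_mul_of_adj hi hj (by omega)).1 h).len_le
    simp [len_sigma hi] at this

/-! ### Descending products -/

theorem descending_of_lt {i m : ℕ} (h : i < m) : descending n i m = 1 := by
  have : i + 1 - m = 0 := by omega
  simp [descending, this]

theorem descending_eq {i m : ℕ} (hm : 1 ≤ m) (h : m ≤ i) :
    descending n i m = sigma n i * descending n (i - 1) m := by
  obtain ⟨k, rfl⟩ := Nat.exists_eq_add_of_le h
  have h1 : m + k + 1 - m = k + 1 := by omega
  have h2 : m + k - 1 + 1 - m = k := by omega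
  simp [descending, h1, h2, List.range'_1_concat]

theorem descending_self {i : ℕ} (hi : 1 ≤ i) : descending n i i = sigma n i := by
  rw [descending_eq hi le_rfl, descending_of_lt (by omega), mul_one]

theorem len_descending {i m : ℕ} (hm : 1 ≤ m) (hi : i < n) :
    len (descending n i m) = i + 1 - m := by
  induction i with
  | zero => rw [descending_of_lt (by omega), len_one]; omega
  | succ i ih =>
    by_cases h : m ≤ i + 1
    · rw [descending_eq hm h, len_mul, len_sigma (by omega), Nat.add_sub_cancel, ih (by omega)]
      omega
    · rw [descending_of_lt (by omega), len_one]; omega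

/-- `σ_j` commutes with every letter of the product. -/
theorem descending_isPrefix_sigma_mul_of_far {i m j : ℕ} (hm : 1 ≤ m) (hi : i < n)
    (hj : 1 ≤ j ∧ j < n) (h : i + 1 < j ∨ j + 1 < m) {α : BraidMonoid n} :
    IsPrefix (descending n i m) (sigma n j * α) ↔ IsPrefix (descending n i m) α := by
  induction i generalizing α with
  | zero => simp [descending_of_lt (n := n) (show 0 < m by omega), one_isPrefix]
  | succ i ih =>
    by_cases hmi : m ≤ i + 1
    · rw [descending_eq hm hmi, sigma_mul_isPrefix_sigma_mul_of_far (by omega) hj (by omega),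
        mul_isPrefix_iff, Nat.add_sub_cancel]
      simp only [ih (by omega) (by omega)]
    · simp [descending_of_lt (n := n) (show i + 1 < m by omega), one_isPrefix]

/-- Only the last letter `σ_m` fails to commute with `σ_j`; the braid relation there extends the
product by `σ_j`. -/
theorem descending_isPrefix_sigma_mul_of_succ_eq {i m j : ℕ} (hi : i < n) (hmi : m ≤ i)
    (hj : 1 ≤ j) (h : j + 1 = m) {α : BraidMonoid n} :
    IsPrefix (descending n i m) (sigma n j * α) ↔ IsPrefix (descending n i j) α := by
  induction i, hmi using Nat.le_induction generalizing α with
  | base =>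
    rw [descending_self (by omega), sigma_isPrefix_sigma_mul_of_adj (by omega) (by omega) (by omega),
      descending_eq hj (by omega), ← h, Nat.add_sub_cancel, descending_self hj]
  | succ i hmi ih =>
    rw [descending_eq (by omega) (by omega),
      sigma_mul_isPrefix_sigma_mul_of_far (by omega) (by omega) (by omega),
      descending_eq hj (by omega), mul_isPrefix_iff, Nat.add_sub_cancel]
    simp only [ih (by omega)]

/-- For `D = σ_i ⋯ σ_m` one has `σ_j D = D σ_{j+1}`: a braid move at `σ_{j+1}σ_j`, commutations
elsewhere. This is the least common multiple of `σ_j` and `D`. -/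
theorem descending_isPrefix_sigma_mul_of_le_of_lt {i m j : ℕ} (hi : i < n) (hm : 1 ≤ m)
    (hmj : m ≤ j) (hji : j < i) {α : BraidMonoid n} :
    IsPrefix (descending n i m) (sigma n j * α) ↔ IsPrefix (descending n i m) α := by
  induction i, hji using Nat.le_induction generalizing α with
  | base =>
    have hj : 1 ≤ j ∧ j < n := by omega
    rw [descending_eq hm (by omega), Nat.succ_eq_add_one, Nat.add_sub_cancel,
      sigma_mul_isPrefix_sigma_mul_of_adj (by omega) hj (by omega),
      descending_eq hm hmj, mul_isPrefix_iff]
    simp only [sigma_mul_isPrefix_sigma_mul_iff hj, mul_isPrefix_iff (a := sigma n j)]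
    have key : ∀ β : BraidMonoid n, IsPrefix (descending n (j - 1) m) (sigma n (j + 1) * β) ↔
        IsPrefix (descending n (j - 1) m) β := fun β =>
      descending_isPrefix_sigma_mul_of_far hm (by omega) (by omega) (by omega)
    simp only [key]
    constructor
    · rintro ⟨β, rfl, h⟩
      exact ⟨_, rfl, β, rfl, h⟩
    · rintro ⟨_, rfl, β, rfl, h⟩
      exact ⟨β, rfl, h⟩
  | succ i hji ih =>
    rw [descending_eq (by omega) (by omega),
      sigma_mul_isPrefix_sigma_mul_of_far (by omega) (by omega) (by omega),
      mul_isPrefix_iff, Nat.add_sub_cancel]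
    simp only [ih (by omega)]

theorem descending_isPrefix_sigma_mul_self {j m : ℕ} (hm : 1 ≤ m) (hmj : m ≤ j) (hj : j < n)
    {α : BraidMonoid n} :
    IsPrefix (descending n j m) (sigma n j * α) ↔ IsPrefix (descending n (j - 1) m) α := by
  rw [descending_eq hm hmj, sigma_mul_isPrefix_sigma_mul_iff (by omega)]

theorem sigma_isPrefix_descending_self {i m : ℕ} (hm : 1 ≤ m) (hmi : m ≤ i) :
    IsPrefix (sigma n i) (descending n i m) := by
  rw [descending_eq hm hmi]
  exact isPrefix_mul_right _ _

theorem sigma_mul_sigma_isPrefix_sigma_mul {i : ℕ} (hi : 1 ≤ i) (hin : i + 1 < n)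
    {α : BraidMonoid n} :
    IsPrefix (sigma n i * sigma n (i + 1)) (sigma n (i + 1) * α) ↔
      IsPrefix (sigma n i * sigma n (i + 1)) α := by
  rw [sigma_mul_isPrefix_sigma_mul_of_adj (by omega) (by omega) (by omega), mul_isPrefix_iff]
  constructor
  · rintro ⟨β, rfl, -⟩
    exact ⟨_, rfl, isPrefix_mul_right _ _⟩
  · rintro ⟨β, rfl, h⟩
    obtain ⟨γ, rfl⟩ := sigma_isPrefix_iff.1 h
    exact ⟨γ, rfl, isPrefix_mul_right _ _⟩

/-! ### The encoded braids form an antichain -/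

/-- A far `σ_k` would have to divide the tail, whose only first letter is `σ_{i-1}`. An adjacent one
would force `σ_k σ_i` to divide the tail, so `k = i - 1` and `σ_i` would divide a product starting
at `σ_{i-2}`. -/
theorem eq_of_sigma_isPrefix_descending {k i m : ℕ} (hk : 1 ≤ k ∧ k < n) (hm : 1 ≤ m)
    (hi : i < n) (h : IsPrefix (sigma n k) (descending n i m)) : k = i := by
  induction i using Nat.strong_induction_on generalizing k with
  | _ i ih =>
  have hlen := h.len_le
  rw [len_sigma hk, len_descending hm hi] at hlen
  by_contra hne
  rw [descending_eq hm (by omega)] at h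
  by_cases hf : k + 1 < i ∨ i + 1 < k
  · have := ih (i - 1) (by omega) hk (by omega)
      ((sigma_isPrefix_sigma_mul_of_far hk (by omega) hf).1 h)
    omega
  · have h' := (sigma_isPrefix_sigma_mul_of_adj hk (by omega) (by omega)).1 h
    have hki := ih (i - 1) (by omega) hk (by omega) ((isPrefix_mul_right _ _).trans h')
    have hlen := h'.len_le
    rw [len_mul, len_sigma hk, len_sigma (by omega), len_descending hm (by omega)] at hlen
    rw [descending_eq hm (by omega), hki, sigma_mul_isPrefix_sigma_mul_iff (by omega)] at h'
    have := ih (i - 1 - 1) (by omega) (by omega) (by omega) h'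
    omega

theorem eq_of_sigma_isPrefix_sigma_mul_sigma {k i : ℕ} (hk : 1 ≤ k ∧ k < n) (hi : 1 ≤ i)
    (hin : i + 1 < n) (h : IsPrefix (sigma n k) (sigma n i * sigma n (i + 1))) : k = i := by
  by_contra hne
  by_cases hf : k + 1 < i ∨ i + 1 < k
  · have := eq_of_sigma_isPrefix_sigma hk (by omega)
      ((sigma_isPrefix_sigma_mul_of_far hk (by omega) hf).1 h)
    omega
  · have h' := ((sigma_isPrefix_sigma_mul_of_adj hk (by omega) (by omega)).1 h).len_le
    rw [len_mul, len_sigma hk, len_sigma (by omega), len_sigma (by omega)] at h'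
    omega

theorem eq_of_descending_isPrefix_descending {i m i' m' : ℕ} (hm : 1 ≤ m) (hmi : m ≤ i)
    (hi : i < n) (hm' : 1 ≤ m') (hi' : i' < n)
    (h : IsPrefix (descending n i m) (descending n i' m')) : i = i' :=
  eq_of_sigma_isPrefix_descending (by omega) hm' hi'
    ((sigma_isPrefix_descending_self hm hmi).trans h)

theorem eq_of_descending_isPrefix_sigma_mul_sigma {i m k : ℕ} (hm : 1 ≤ m) (hmi : m ≤ i)
    (hi : i < n) (hk : 1 ≤ k) (hkn : k + 1 < n)
    (h : IsPrefix (descending n i m) (sigma n k * sigma n (k + 1))) : i = k ∧ m = i := by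
  have hik := eq_of_sigma_isPrefix_sigma_mul_sigma (by omega) hk hkn
    ((sigma_isPrefix_descending_self hm hmi).trans h)
  subst hik
  refine ⟨rfl, ?_⟩
  by_contra hne
  rw [descending_eq hm hmi, sigma_mul_isPrefix_sigma_mul_iff (by omega)] at h
  have := eq_of_sigma_isPrefix_sigma (by omega) (by omega)
    ((sigma_isPrefix_descending_self hm (by omega)).trans h)
  omega

theorem not_sigma_mul_sigma_isPrefix_descending {i m k : ℕ} (hm : 1 ≤ m)
    (hi : i < n) (hk : 1 ≤ k) (hkn : k + 1 < n) :
    ¬ IsPrefix (sigma n k * sigma n (k + 1)) (descending n i m) := by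
  intro h
  have hki := eq_of_sigma_isPrefix_descending (by omega) hm hi ((isPrefix_mul_right _ _).trans h)
  subst hki
  have hlen := h.len_le
  rw [len_mul, len_sigma (by omega), len_sigma (by omega), len_descending hm hi] at hlen
  rw [descending_eq hm (by omega), sigma_mul_isPrefix_sigma_mul_iff (by omega)] at h
  have := eq_of_sigma_isPrefix_descending (by omega) hm (by omega) h
  omega

theorem eq_of_sigma_mul_sigma_isPrefix_sigma_mul_sigma {k l : ℕ} (hk : 1 ≤ k) (hkn : k + 1 < n)
    (hl : 1 ≤ l) (hln : l + 1 < n)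
    (h : IsPrefix (sigma n k * sigma n (k + 1)) (sigma n l * sigma n (l + 1))) : k = l :=
  eq_of_sigma_isPrefix_sigma_mul_sigma (by omega) hl hln ((isPrefix_mul_right _ _).trans h)

/-! ### Lexicographically minimal words -/

theorem list_cons_le_cons_iff {α : Type*} [LinearOrder α] {a b : α} {u v : List α} :
    a :: u ≤ b :: v ↔ a < b ∨ a = b ∧ u ≤ v := by
  rw [← not_lt, List.cons_lt_cons_iff, ← not_lt]
  rcases lt_trichotomy a b with h | rfl | h
  · simp [h, h.not_gt, h.ne']
  · simp
  · simp [h, h.not_gt, h.ne']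

theorem toBraid_lexRep (β : BraidMonoid n) : toBraid (lexRep β) = β :=
  (exists_isLeast β).choose_spec.1

theorem lexRep_le {β : BraidMonoid n} {v : List (Idx n)} (h : toBraid v = β) : lexRep β ≤ v :=
  (exists_isLeast β).choose_spec.2 h

theorem mem_lexLang_iff {w : List (Idx n)} :
    w ∈ lexLang n ↔ ∀ v, toBraid v = toBraid w → w ≤ v := by
  constructor
  · rintro ⟨β, rfl⟩ v hv
    exact lexRep_le (hv.trans (toBraid_lexRep β))
  · intro h
    exact ⟨toBraid w, le_antisymm (lexRep_le rfl) (h _ (toBraid_lexRep _))⟩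

theorem lexRep_mem (β : BraidMonoid n) : lexRep β ∈ lexLang n := ⟨β, rfl⟩

/-- By left cancellation, the words for the whole braid that start with `k` are `k` followed by the
words for the braid of `u`. -/
theorem cons_mem_lexLang_iff {k : Idx n} {u : List (Idx n)} :
    k :: u ∈ lexLang n ↔
      u ∈ lexLang n ∧ ∀ i < k, ¬ IsPrefix (gen i) (gen k * toBraid u) := by
  simp only [mem_lexLang_iff]
  constructor
  · intro h
    constructor
    · intro v hv
      have := h (k :: v) (by rw [toBraid_cons, toBraid_cons, hv])
      rw [list_cons_le_cons_iff] at this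
      simpa using this
    · rintro i hi ⟨c, hc⟩
      obtain ⟨v, rfl⟩ := toBraid_surjective n c
      have := h (i :: v) (by rw [toBraid_cons, toBraid_cons, hc])
      rw [list_cons_le_cons_iff] at this
      rcases this with h' | ⟨h', -⟩
      · exact lt_asymm hi h'
      · exact hi.ne' h'
  · rintro ⟨h, hk⟩ v hv
    rcases v with _ | ⟨i, v⟩
    · have := congrArg len hv
      simp at this
    · rw [toBraid_cons, toBraid_cons] at hv
      rw [list_cons_le_cons_iff]
      rcases lt_trichotomy i k with hik | rfl | hik
      · exact absurd ⟨_, hv⟩ (hk i hik)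
      · exact Or.inr ⟨rfl, h v (gen_mul_cancel hv)⟩
      · exact Or.inl hik

/-- The braid `α` may follow the word `w` in a lexicographically minimal way. -/
def Follows : List (Idx n) → BraidMonoid n → Prop
  | [], _ => True
  | k :: w, α => Follows w α ∧ ∀ i < k, ¬ IsPrefix (gen i) (gen k * (toBraid w * α))

theorem append_lexRep_mem_iff {w : List (Idx n)} {α : BraidMonoid n} :
    w ++ lexRep α ∈ lexLang n ↔ Follows w α := by
  induction w with
  | nil => simp [Follows, lexRep_mem]
  | cons k w ih =>
    rw [List.cons_append, cons_mem_lexLang_iff, ih, toBraid_append, toBraid_lexRep]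
    rfl

theorem mem_forbidden_iff {w : List (Idx n)} {α : BraidMonoid n} :
    α ∈ forbidden w ↔ ¬ Follows w α := by
  rw [← append_lexRep_mem_iff]
  rfl

theorem lexRep_one : lexRep (1 : BraidMonoid n) = [] := by
  have := congrArg len (toBraid_lexRep (1 : BraidMonoid n))
  simpa using this

theorem mem_lexLang_iff_follows_one {w : List (Idx n)} : w ∈ lexLang n ↔ Follows w 1 := by
  rw [← append_lexRep_mem_iff, lexRep_one, List.append_nil]

theorem follows_concat_iff {w : List (Idx n)} {j : Idx n} {α : BraidMonoid n} :
    Follows (w ++ [j]) α ↔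
      Follows w (gen j * α) ∧ ∀ i < j, ¬ IsPrefix (gen i) (gen j * α) := by
  induction w with
  | nil => simp [Follows, toBraid_nil]
  | cons k w ih =>
    simp only [List.cons_append, Follows, ih, toBraid_append, toBraid_cons, toBraid_nil, mul_one,
      mul_assoc]
    tauto

/-- Forbidden sets are closed under right multiplication; with `α = 1` this makes `lexLang`
prefix-closed. -/
theorem Follows.of_mul {w : List (Idx n)} {α β : BraidMonoid n} (h : Follows w (α * β)) :
    Follows w α := by
  induction w with
  | nil => trivial
  | cons k w ih =>
    refine ⟨ih h.1, fun i hi hp => h.2 i hi ?_⟩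
    simpa only [mul_assoc] using hp.trans (isPrefix_mul_right _ β)

theorem concat_mem_lexLang_iff {w : List (Idx n)} {j : Idx n} :
    w ++ [j] ∈ lexLang n ↔ Follows w (gen j) := by
  rw [mem_lexLang_iff_follows_one, follows_concat_iff, mul_one, and_iff_left_iff_imp]
  intro _ i hi h
  rw [← sigma_eq_gen, ← sigma_eq_gen] at h
  exact hi.ne (Subtype.ext (eq_of_sigma_isPrefix_sigma i.2 j.2 h))

/-! ### The ideal generated by an encoded set -/

/-- The braid `α` is a multiple of some element of `encoded f`. -/
def Covers (f : Idx n → ℤ) (α : BraidMonoid n) : Prop := ∃ x ∈ encoded f, IsPrefix x α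

/-- The property of admissible functions that holds for those describing minimal forbidden
prefixes; it makes `encoded f` an antichain. -/
structure Reduced (f : Idx n → ℤ) : Prop where
  eq_of_far : ∀ i k : Idx n, f i = -1 → k.1 + 1 < i.1 → f k = k.1
  ne_of_adj : ∀ i k : Idx n, f i = -1 → k.1 + 1 = i.1 → f k ≠ k.1

theorem mem_encoded_iff {f : Idx n → ℤ} (hf : Admissible f) {x : BraidMonoid n} :
    x ∈ encoded f ↔
      (∃ (i : Idx n) (m : ℕ), f i = m ∧ 1 ≤ m ∧ m ≤ i.1 ∧ x = descending n i.1 m) ∨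
      ∃ (i : Idx n) (k : ℕ), f i = -1 ∧ 1 ≤ k ∧ k + 1 = i.1 ∧
        x = sigma n k * sigma n (k + 1) := by
  constructor
  · rintro (⟨i, hi, rfl⟩ | ⟨i, hi, rfl⟩)
    · have := hf.le_self i
      exact Or.inl ⟨i, (f i).toNat, by omega, by omega, by omega, rfl⟩
    · have := hf.one_ne i
      have := i.2
      have h : i.1 - 1 + 1 = i.1 := by omega
      exact Or.inr ⟨i, i.1 - 1, hi, by omega, h, by rw [h]⟩
  · rintro (⟨i, m, hi, hm, hmi, rfl⟩ | ⟨i, k, hi, hk, hki, rfl⟩)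
    · exact Or.inl ⟨i, by omega, by rw [hi, Int.toNat_natCast]⟩
    · exact Or.inr ⟨i, hi, by rw [← hki, Nat.add_sub_cancel]⟩

theorem covers_iff {f : Idx n → ℤ} (hf : Admissible f) {α : BraidMonoid n} :
    Covers f α ↔
      (∃ (i : Idx n) (m : ℕ), f i = m ∧ 1 ≤ m ∧ m ≤ i.1 ∧ IsPrefix (descending n i.1 m) α) ∨
      ∃ (i : Idx n) (k : ℕ), f i = -1 ∧ 1 ≤ k ∧ k + 1 = i.1 ∧
        IsPrefix (sigma n k * sigma n (k + 1)) α := by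
  unfold Covers
  simp only [mem_encoded_iff hf]
  constructor
  · rintro ⟨x, ⟨i, m, h1, h2, h3, rfl⟩ | ⟨i, m, h1, h2, h3, rfl⟩, h⟩
    · exact Or.inl ⟨i, m, h1, h2, h3, h⟩
    · exact Or.inr ⟨i, m, h1, h2, h3, h⟩
  · rintro (⟨i, m, h1, h2, h3, h⟩ | ⟨i, m, h1, h2, h3, h⟩)
    · exact ⟨_, Or.inl ⟨i, m, h1, h2, h3, rfl⟩, h⟩
    · exact ⟨_, Or.inr ⟨i, m, h1, h2, h3, rfl⟩, h⟩

/-- First letters separate all pairs except `σ_k ≼ σ_k σ_{k+1}`, which `Reduced.ne_of_adj` excludes.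
-/
theorem eq_of_mem_encoded_of_isPrefix {f : Idx n → ℤ} (hf : Admissible f) (hr : Reduced f)
    {x y : BraidMonoid n} (hx : x ∈ encoded f) (hy : y ∈ encoded f) (h : IsPrefix x y) :
    x = y := by
  rcases (mem_encoded_iff hf).1 hx with ⟨i, m, hi, hm, hmi, rfl⟩ | ⟨i, k, hi, hk, hki, rfl⟩ <;>
    rcases (mem_encoded_iff hf).1 hy with ⟨i', m', hi', hm', hmi', rfl⟩ | ⟨i', k', hi', hk', hki', rfl⟩
  · obtain rfl := Subtype.ext (eq_of_descending_isPrefix_descending hm hmi i.2.2 hm' i'.2.2 h)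
    obtain rfl : m = m' := by omega
    rfl
  · have := eq_of_descending_isPrefix_sigma_mul_sigma hm hmi i.2.2 hk' (by have := i'.2; omega) h
    exact absurd (by omega) (hr.ne_of_adj i' i hi' (by omega))
  · exact absurd h (not_sigma_mul_sigma_isPrefix_descending hm' i'.2.2 hk (by have := i.2; omega))
  · rw [eq_of_sigma_mul_sigma_isPrefix_sigma_mul_sigma hk (by have := i.2; omega) hk'
      (by have := i'.2; omega) h]

/-- The shape and first letter of an encoded braid determine its index, and its length then
determines the value. `Reduced` is not needed, so uniqueness holds among all admissible functions.
-/
theorem eq_of_encoded_eq_of_ne_zero {f g : Idx n → ℤ} (hf : Admissible f) (hg : Admissible g)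
    (h : encoded f = encoded g) (i : Idx n) (hi : f i ≠ 0) : g i = f i := by
  have hin := i.2
  have hcod := hf.mem_codomain i
  have hle := hf.le_self i
  by_cases h1 : f i = -1
  · have h2 := hf.one_ne i
    have hmem : sigma n (i.1 - 1) * sigma n (i.1 - 1 + 1) ∈ encoded g := by
      rw [← h, mem_encoded_iff hf]
      exact Or.inr ⟨i, i.1 - 1, h1, by omega, by omega, rfl⟩
    rcases (mem_encoded_iff hg).1 hmem with ⟨i', m, hi', hm, hmi, he⟩ | ⟨i', k, hi', hk, hki, he⟩
    · refine absurd ?_ (not_sigma_mul_sigma_isPrefix_descending (n := n) (k := i.1 - 1) hm i'.2.2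
        (by omega) (by omega))
      rw [he]
      exact IsPrefix.refl _
    · have hin' := i'.2
      have := eq_of_sigma_mul_sigma_isPrefix_sigma_mul_sigma (n := n) (k := i.1 - 1) (l := k)
        (by omega) (by omega) (by omega) (by omega) (by rw [he]; exact IsPrefix.refl _)
      obtain rfl : i = i' := Subtype.ext (by omega)
      rw [hi', h1]
  · obtain ⟨m, hm⟩ := Int.eq_ofNat_of_zero_le (show 0 ≤ f i by omega)
    have hmem : descending n i.1 m ∈ encoded g := by
      rw [← h, mem_encoded_iff hf]
      exact Or.inl ⟨i, m, hm, by omega, by omega, rfl⟩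
    rcases (mem_encoded_iff hg).1 hmem with ⟨i', m', hi', hm', hmi', he⟩ | ⟨i', k, hi', hk, hki, he⟩
    · have := eq_of_descending_isPrefix_descending (n := n) (i := i.1) (m := m) (i' := i'.1)
        (m' := m') (by omega) (by omega) i.2.2 hm' i'.2.2 (by rw [he]; exact IsPrefix.refl _)
      obtain rfl := Subtype.ext this
      have := congrArg len he
      rw [len_descending (by omega) i.2.2, len_descending hm' i.2.2] at this
      omega
    · have hin' := i'.2
      refine absurd ?_ (not_sigma_mul_sigma_isPrefix_descending (n := n) (i := i.1) (m := m)
        (k := k) (by omega) i.2.2 hk (by omega))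
      rw [he]
      exact IsPrefix.refl _

theorem encoded_injective {f g : Idx n → ℤ} (hf : Admissible f) (hg : Admissible g)
    (h : encoded f = encoded g) : f = g := by
  funext i
  by_cases hi : f i = 0
  · by_cases hi' : g i = 0
    · rw [hi, hi']
    · exact eq_of_encoded_eq_of_ne_zero hg hf h.symm i hi'
  · exact (eq_of_encoded_eq_of_ne_zero hf hg h i hi).symm

theorem covers_gen_iff {f : Idx n → ℤ} (hf : Admissible f) (j : Idx n) :
    Covers f (gen j) ↔ f j = j.1 := by
  have hj := j.2
  rw [covers_iff hf]
  constructor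
  · rintro (⟨i, m, hi, hm, hmi, h⟩ | ⟨i, k, hi, hk, hki, h⟩)
    · have hlen := h.len_le
      rw [len_descending hm i.2.2, len_gen] at hlen
      obtain rfl : m = i.1 := by omega
      rw [descending_self hm, ← sigma_eq_gen] at h
      obtain rfl := Subtype.ext (eq_of_sigma_isPrefix_sigma i.2 j.2 h)
      exact hi
    · have hlen := h.len_le
      have := i.2
      rw [len_mul, len_sigma (by omega), len_sigma (by omega), len_gen] at hlen
      omega
  · intro h
    refine Or.inl ⟨j, j.1, h, hj.1, le_rfl, ?_⟩
    rw [descending_self hj.1, sigma_eq_gen]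
    exact IsPrefix.refl _

/-! ### Appending a letter -/

theorem Admissible.update {f : Idx n → ℤ} (hf : Admissible f) (j : Idx n) (hj : f j ≠ j.1) :
    Admissible (update f j) := by
  have hjn := j.2
  have hj1 := hf.le_self j
  refine ⟨fun i => ?_, fun i => ?_, fun i => ?_⟩ <;>
  · have hin := i.2
    have h1 := hf.le_self i
    have h2 := hf.mem_codomain i
    unfold PosBraid.update
    split_ifs <;> omega

/-- After `σ_j` is appended only `j` can carry the value `-1`, and positions below `j - 1` carry
their own index. -/
theorem Reduced.update {f : Idx n → ℤ} (j : Idx n) :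
    Reduced (update f j) := by
  have hjn := j.2
  have key : ∀ i : Idx n, PosBraid.update f j i = -1 → i.1 = j.1 ∧ f j ≠ (j.1 : ℤ) - 1 := by
    intro i hi
    unfold PosBraid.update at hi
    split_ifs at hi <;> omega
  constructor
  · intro i k hi hk
    rw [(key i hi).1] at hk
    simp [PosBraid.update, hk]
  · intro i k hi hk
    obtain ⟨hij, hfj⟩ := key i hi
    have hkn := k.2
    unfold PosBraid.update
    split_ifs <;> omega

section Update

variable {f : Idx n → ℤ} {j : Idx n}

theorem covers_update_of_far (hf : Admissible f) (hj : f j ≠ j.1) {k : ℕ} (hk : 1 ≤ k)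
    (hkj : k + 1 < j.1) {α : BraidMonoid n} (h : IsPrefix (sigma n k) α) :
    Covers (update f j) α := by
  have hjn := j.2
  refine (covers_iff (hf.update j hj)).2 (Or.inl ⟨⟨k, by omega⟩, k, ?_, hk, le_rfl, ?_⟩)
  · simp [update, hkj]
  · rwa [descending_self hk]

theorem covers_update_of_adj (hf : Admissible f) (hj : f j ≠ j.1) {k : ℕ} (hk : 1 ≤ k)
    (hkj : k + 1 = j.1) {α : BraidMonoid n} (h : IsPrefix (sigma n k * sigma n (k + 1)) α) :
    Covers (update f j) α := by
  have hjn := j.2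
  rw [covers_iff (hf.update j hj)]
  -- If `f j = j - 1`, the generator `σ_{j-1}` is itself encoded and makes `σ_{j-1}σ_j` redundant.
  by_cases hfj : f j = k
  · refine Or.inl ⟨⟨k, by omega⟩, k, ?_, hk, le_rfl, ?_⟩
    · unfold update
      simp only
      split_ifs <;> omega
    · rw [descending_self hk]
      exact (isPrefix_mul_right _ _).trans h
  · refine Or.inr ⟨j, k, ?_, hk, hkj, h⟩
    unfold update
    split_ifs <;> omega

theorem covers_update_of_covers (hf : Admissible f) (hr : Reduced f) (hj : f j ≠ j.1)
    {α : BraidMonoid n} (h : Covers f (sigma n j.1 * α)) : Covers (update f j) α := by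
  have hjn := j.2
  rcases (covers_iff hf).1 h with ⟨i, m, hi, hm, hmi, h⟩ | ⟨i, k, hi, hk, hki, h⟩
  · have hin := i.2
    rcases lt_trichotomy i.1 j.1 with hij | hij | hij
    · have h' := (sigma_isPrefix_descending_self hm hmi).trans h
      by_cases hij' : i.1 + 1 = j.1
      · rw [sigma_isPrefix_sigma_mul_of_adj hin hjn (Or.inl hij'), ← hij'] at h'
        exact covers_update_of_adj hf hj hin.1 hij' h'
      · rw [sigma_isPrefix_sigma_mul_of_far hin hjn (by omega)] at h'
        exact covers_update_of_far hf hj hin.1 (by omega) h'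
    · obtain rfl := Subtype.ext hij
      rw [descending_isPrefix_sigma_mul_self hm hmi hin.2] at h
      refine (covers_iff (hf.update i hj)).2
        (Or.inl ⟨⟨i.1 - 1, by omega⟩, m, ?_, hm, by simp only; omega, h⟩)
      unfold update
      simp only
      split_ifs <;> omega
    · rw [covers_iff (hf.update j hj)]
      by_cases hmj : j.1 + 1 = m
      · rw [descending_isPrefix_sigma_mul_of_succ_eq hin.2 hmi hjn.1 hmj] at h
        refine Or.inl ⟨i, j.1, ?_, hjn.1, hij.le, h⟩
        unfold update
        split_ifs <;> omega
      · have h' : IsPrefix (descending n i.1 m) α := by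
          by_cases hmj' : m ≤ j.1
          · exact (descending_isPrefix_sigma_mul_of_le_of_lt hin.2 hm hmj' hij).1 h
          · exact (descending_isPrefix_sigma_mul_of_far hm hin.2 hjn (by omega)).1 h
        refine Or.inl ⟨i, m, ?_, hm, hmi, h'⟩
        unfold update
        split_ifs <;> omega
  · have hin := i.2
    rcases lt_trichotomy i.1 j.1 with hij | hij | hij
    · have h' := (isPrefix_mul_right _ _).trans h
      rw [sigma_isPrefix_sigma_mul_of_far (by omega) hjn (by omega)] at h'
      exact covers_update_of_far hf hj hk (by omega) h'
    · rw [show j.1 = k + 1 by omega, sigma_mul_sigma_isPrefix_sigma_mul hk (by omega)] at h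
      exact covers_update_of_adj hf hj hk (by omega) h
    · by_cases hij' : j.1 + 1 < i.1
      · exact absurd (hr.eq_of_far i j hi hij') hj
      · obtain rfl : k = j.1 := by omega
        rw [sigma_mul_isPrefix_sigma_mul_iff hjn] at h
        refine (covers_iff (hf.update j hj)).2 (Or.inl ⟨i, i.1, ?_, hin.1, le_rfl, ?_⟩)
        · unfold update
          split_ifs <;> omega
        · rwa [descending_self hin.1, ← hki]

theorem covers_or_of_covers_update (hf : Admissible f) (hr : Reduced f) (hj : f j ≠ j.1)
    {α : BraidMonoid n} (h : Covers (update f j) α) :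
    Covers f (sigma n j.1 * α) ∨ ∃ i < j, IsPrefix (sigma n i.1) (sigma n j.1 * α) := by
  have hjn := j.2
  rcases (covers_iff (hf.update j hj)).1 h with ⟨i, m, hi, hm, hmi, h⟩ | ⟨i, k, hi, hk, hki, h⟩
  · have hin := i.2
    rcases lt_trichotomy i.1 j.1 with hij | hij | hij
    · by_cases hij' : i.1 + 1 = j.1
      · left
        have hfj : f j = m := by
          unfold update at hi
          split_ifs at hi <;> omega
        have := hf.le_self j
        refine (covers_iff hf).2 (Or.inl ⟨j, m, hfj, hm, by omega, ?_⟩)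
        rw [descending_isPrefix_sigma_mul_self hm (by omega) hjn.2]
        rwa [← hij', Nat.add_sub_cancel]
      · right
        refine ⟨i, hij, ?_⟩
        rw [sigma_isPrefix_sigma_mul_of_far hin hjn (by omega)]
        exact (sigma_isPrefix_descending_self hm hmi).trans h
    · exfalso
      unfold update at hi
      split_ifs at hi <;> omega
    · left
      by_cases hfi : f i = -1
      · have hij' : i.1 = j.1 + 1 := by
          by_contra hne
          exact hj (hr.eq_of_far i j hfi (by omega))
        refine (covers_iff hf).2 (Or.inr ⟨i, j.1, hfi, hjn.1, hij'.symm, ?_⟩)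
        rw [sigma_mul_isPrefix_sigma_mul_iff hjn, ← hij']
        exact (sigma_isPrefix_descending_self hm hmi).trans h
      · by_cases hfi' : f i = (j.1 : ℤ) + 1
        · obtain rfl : m = j.1 := by
            unfold update at hi
            split_ifs at hi <;> omega
          refine (covers_iff hf).2 (Or.inl ⟨i, j.1 + 1, by omega, by omega, hij, ?_⟩)
          rwa [descending_isPrefix_sigma_mul_of_succ_eq hin.2 hij hjn.1 rfl]
        · have hfm : f i = m := by
            unfold update at hi
            split_ifs at hi <;> omega
          refine (covers_iff hf).2 (Or.inl ⟨i, m, hfm, hm, hmi, ?_⟩)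
          by_cases hmj' : m ≤ j.1
          · exact (descending_isPrefix_sigma_mul_of_le_of_lt hin.2 hm hmj' hij).2 h
          · exact (descending_isPrefix_sigma_mul_of_far hm hin.2 hjn (by omega)).2 h
  · right
    have hin := i.2
    have hij : i.1 = j.1 := by
      unfold update at hi
      split_ifs at hi <;> omega
    refine ⟨⟨k, by omega⟩, show k < j.1 by omega, ?_⟩
    change IsPrefix (sigma n k) _
    rw [sigma_isPrefix_sigma_mul_of_adj (by omega) hjn (by omega)]
    rwa [← hij, ← hki]

theorem covers_update_iff (hf : Admissible f) (hr : Reduced f) (hj : f j ≠ j.1)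
    {α : BraidMonoid n} :
    Covers (update f j) α ↔
      Covers f (gen j * α) ∨ ∃ i < j, IsPrefix (gen i) (gen j * α) := by
  simp only [← sigma_eq_gen]
  refine ⟨covers_or_of_covers_update hf hr hj, ?_⟩
  rintro (h | ⟨i, hi, h⟩)
  · exact covers_update_of_covers hf hr hj h
  · have hi' : i.1 < j.1 := hi
    by_cases hij : i.1 + 1 = j.1
    · rw [sigma_isPrefix_sigma_mul_of_adj i.2 j.2 (Or.inl hij), ← hij] at h
      exact covers_update_of_adj hf hj i.2.1 hij h
    · rw [sigma_isPrefix_sigma_mul_of_far i.2 j.2 (by omega)] at h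
      exact covers_update_of_far hf hj i.2.1 (by omega) h

end Update

/-! ### Minimal forbidden prefixes, by induction on the word -/

/-- The function `f` describes the forbidden prefixes after `w`. -/
structure Describes (f : Idx n → ℤ) (w : List (Idx n)) : Prop where
  admissible : Admissible f
  reduced : Reduced f
  mem_forbidden_iff : ∀ α, α ∈ forbidden w ↔ Covers f α

/-- An antichain that generates an upward closed set is its set of minimal elements. -/
theorem Describes.minForbidden_eq {f : Idx n → ℤ} {w : List (Idx n)} (h : Describes f w) :
    minForbidden w = encoded f := by
  ext x
  constructor
  · rintro ⟨hx, hmin⟩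
    obtain ⟨y, hy, hyx⟩ := (h.mem_forbidden_iff x).1 hx
    rwa [← hmin y ((h.mem_forbidden_iff y).2 ⟨y, hy, IsPrefix.refl y⟩) hyx]
  · intro hx
    refine ⟨(h.mem_forbidden_iff x).2 ⟨x, hx, IsPrefix.refl x⟩, fun y hy hyx => ?_⟩
    obtain ⟨z, hz, hzy⟩ := (h.mem_forbidden_iff y).1 hy
    obtain rfl := eq_of_mem_encoded_of_isPrefix h.admissible h.reduced hz hx (hzy.trans hyx)
    obtain ⟨c, rfl⟩ := hzy
    obtain ⟨d, hd⟩ := hyx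
    -- The two braids divide each other, so the cofactor `c` has length `0` and is trivial.
    have hlen := congrArg len hd
    simp only [len_mul] at hlen
    obtain ⟨v, rfl⟩ := toBraid_surjective n c
    have hv : v = [] := List.eq_nil_of_length_eq_zero (by rw [← len_toBraid]; omega)
    rw [hv, toBraid_nil, mul_one]

theorem Describes.concat_mem_iff {f : Idx n → ℤ} {w : List (Idx n)} (h : Describes f w)
    (j : Idx n) : w ++ [j] ∈ lexLang n ↔ f j ≠ j.1 := by
  rw [concat_mem_lexLang_iff, Ne, ← covers_gen_iff h.admissible, ← h.mem_forbidden_iff,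
    PosBraid.mem_forbidden_iff, not_not]

theorem Describes.update {f : Idx n → ℤ} {w : List (Idx n)} (h : Describes f w) {j : Idx n}
    (hj : f j ≠ j.1) : Describes (update f j) (w ++ [j]) := by
  refine ⟨h.admissible.update j hj, Reduced.update j, fun α => ?_⟩
  rw [covers_update_iff h.admissible h.reduced hj, ← h.mem_forbidden_iff,
    PosBraid.mem_forbidden_iff, PosBraid.mem_forbidden_iff, follows_concat_iff, not_and_or]
  simp only [not_forall, not_not, exists_prop]

theorem describes_zero_nil : Describes (fun _ : Idx n => (0 : ℤ)) [] := by
  refine ⟨⟨by simp, by simp, by simp⟩, ⟨by simp, by simp⟩, fun α => ?_⟩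
  rw [mem_forbidden_iff]
  simp [Follows, Covers, encoded]

theorem exists_describes {w : List (Idx n)} (hw : w ∈ lexLang n) : ∃ f, Describes f w := by
  induction w using List.reverseRecOn with
  | nil => exact ⟨_, describes_zero_nil⟩
  | append_singleton w j ih =>
    have hj := concat_mem_lexLang_iff.1 hw
    -- This form lets `Follows.of_mul` drop the last letter, so that `w` itself is in `lexLang`.
    rw [← one_mul (gen j)] at hj
    obtain ⟨f, hf⟩ := ih (mem_lexLang_iff_follows_one.2 hj.of_mul)
    exact ⟨_, hf.update ((hf.concat_mem_iff j).1 hw)⟩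

theorem encoded_finite_and_ncard_le (f : Idx n → ℤ) :
    (encoded f).Finite ∧ (encoded f).ncard ≤ n - 1 := by
  -- At most one braid per index; the value where `f i = 0` is irrelevant, as only an inclusion is
  -- used.
  let φ : Idx n → BraidMonoid n := fun i =>
    if f i = -1 then sigma n (i.1 - 1) * sigma n i.1 else descending n i.1 (f i).toNat
  have hsub : encoded f ⊆ φ '' Set.univ := by
    rintro x (⟨i, hi, rfl⟩ | ⟨i, hi, rfl⟩)
    · exact ⟨i, trivial, if_neg (by omega)⟩
    · exact ⟨i, trivial, if_pos hi⟩
  have hcard : Nat.card (Idx n) = n - 1 := by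
    rw [Nat.subtype_card (Finset.Ico 1 n) (by simp), Nat.card_Ico]
  have hfin : Finite (Idx n) := (Set.finite_Ico 1 n).to_subtype
  refine ⟨(Set.toFinite _).subset hsub, ?_⟩
  calc (encoded f).ncard ≤ (φ '' Set.univ).ncard := Set.ncard_le_ncard hsub (Set.toFinite _)
    _ ≤ (Set.univ : Set (Idx n)).ncard := Set.ncard_image_le (Set.toFinite _)
    _ = n - 1 := by rw [Set.ncard_univ, hcard]

end PosBraid

theorem proposition4p8 (n : ℕ) (hn : 1 ≤ n) (w : List (PosBraid.Idx n))
    (hw : w ∈ PosBraid.lexLang n) :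
    (∃! f : PosBraid.Idx n → ℤ,
      PosBraid.Admissible f ∧ PosBraid.minForbidden w = PosBraid.encoded f) ∧
    (∀ f : PosBraid.Idx n → ℤ, PosBraid.Admissible f →
      PosBraid.minForbidden w = PosBraid.encoded f →
      ∀ j : PosBraid.Idx n,
        (w ++ [j] ∈ PosBraid.lexLang n ↔ f j ≠ (j.1 : ℤ)) ∧
        (w ++ [j] ∈ PosBraid.lexLang n →
          PosBraid.Admissible (PosBraid.update f j) ∧
          PosBraid.minForbidden (w ++ [j]) = PosBraid.encoded (PosBraid.update f j))) ∧
    (PosBraid.minForbidden w).Finite ∧ (PosBraid.minForbidden w).ncard ≤ n - 1 := by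
  obtain ⟨f, hf⟩ := PosBraid.exists_describes hw
  have huniq : ∀ g, PosBraid.Admissible g → PosBraid.minForbidden w = PosBraid.encoded g →
      g = f := fun g hg h =>
    PosBraid.encoded_injective hg hf.admissible (h.symm.trans hf.minForbidden_eq)
  refine ⟨⟨f, ⟨hf.admissible, hf.minForbidden_eq⟩, fun g hg => huniq g hg.1 hg.2⟩, ?_, ?_⟩
  · intro g hg h j
    -- By uniqueness the given function is the one constructed by induction, and so satisfies
    -- `Reduced`.
    obtain rfl := huniq g hg h
    refine ⟨hf.concat_mem_iff j, fun hj => ?_⟩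
    have hu := hf.update ((hf.concat_mem_iff j).1 hj)
    exact ⟨hu.admissible, hu.minForbidden_eq⟩
  · rw [hf.minForbidden_eq]
    exact PosBraid.encoded_finite_and_ncard_le f
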